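/- For measurable $f:\mathbb R\to\mathbb R$ let $d_f(s)=|\{x\in\mathbb R:|f(x)|>s\}|$ be its distribution function, $f^*(t)=\inf\{s>0:\ d_f(s)\le t\}$ ($t\ge 0$) its non-increasing rearrangement, and $f^\#(x)=f^*(2|x|)$ ($x\in\mathbb R$). A function $f:\mathbb R\to\mathbb R$ is called bell-shaped if it is even, non-negative, and non-increasing on $(0,\infty)$. Let $p>2$ and $\omega>0$. Then the constrained minimization problem $$N_0[v]=\frac14\int_{\mathbb R}|v'(x)|^2\,dx+\omega\int_{\mathbb R}|v(x)|\,dx\ \to\ \min,\qquad \text{subject to}\quad \int_{\mathbb R}|v(x)|^{p/2}\,dx=1,$$ over real-valued $v\in H^1(\mathbb R)\cap L^1(\mathbb R)$ (with $v'$ the weak derivative) has a bell-shaped solution $\varphi$ with $\varphi=\varphi^\#$. That is, there is a function $\varphi\in H^1(\mathbb R)\cap L^1(\mathbb R)$ with $\int_{\mathbb R}|\varphi|^{p/2}\,dx=1$ which is bell-shaped, satisfies $\varphi(x)=\varphi^\#(x)$ for all $x\in\mathbb R$, and satisfies $N_0[\varphi]\le N_0[v]$ for every $v\in H^1(\mathbb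 R)\cap L^1(\mathbb R)$ with $\int_{\mathbb R}|v|^{p/2}\,dx=1$. -/

import Mathlib

open MeasureTheory Set

namespace Compacton

/-- `g` is a weak (distributional) derivative of `f` on `ℝ`. -/
def IsWeakDeriv (f g : ℝ → ℝ) : Prop :=
  LocallyIntegrable f volume ∧ LocallyIntegrable g volume ∧
    ∀ η : ℝ → ℝ, ContDiff ℝ (⊤ : ℕ∞) η → HasCompactSupport η →
      ∫ x, f x * deriv η x = -∫ x, g x * η x

/-- Weak derivatives are unique up to null sets. -/
theorem IsWeakDeriv.ae_eq {f g h : ℝ → ℝ} (hg : IsWeakDeriv f g) (hh : IsWeakDeriv f h) :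
    g =ᵐ[volume] h := by
  refine ae_eq_of_integral_contDiff_smul_eq hg.2.1 hh.2.1 fun η hη hc => ?_
  have h1 := hg.2.2 η hη hc
  have h2 := hh.2.2 η hη hc
  simp only [smul_eq_mul, mul_comm (η _)]
  linarith

open Classical in
/-- The weak derivative `f'` of `f` (a chosen representative of its class modulo null sets),
and `0` if `f` has no weak derivative. -/
noncomputable def weakDeriv (f : ℝ → ℝ) : ℝ → ℝ :=
  if h : ∃ g, IsWeakDeriv f g then h.choose else 0

theorem IsWeakDeriv.ae_eq_weakDeriv {f g : ℝ → ℝ} (hg : IsWeakDeriv f g) :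
    weakDeriv f =ᵐ[volume] g := by
  have h : ∃ g, IsWeakDeriv f g := ⟨g, hg⟩
  rw [weakDeriv, dif_pos h]
  exact h.choose_spec.ae_eq hg

/-- `f ∈ H¹(ℝ)`: `f ∈ L²` and `f` has a weak derivative in `L²`. -/
def MemH1 (f : ℝ → ℝ) : Prop :=
  MemLp f 2 volume ∧ ∃ g, IsWeakDeriv f g ∧ MemLp g 2 volume

/-- The functional `N₀[v] = (1/4) ∫ |v'|² + ω ∫ |v|`. -/
noncomputable def energy (ω : ℝ) (v : ℝ → ℝ) : ℝ :=
  (1 / 4) * (∫ x, |weakDeriv v x| ^ 2) + ω * ∫ x, |v x|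

/-- The admissible functions: `v ∈ H¹(ℝ) ∩ L¹(ℝ)` with `∫ |v|^(p/2) = 1`
(the integrand being integrable). -/
def constraintSet (p : ℝ) : Set (ℝ → ℝ) :=
  {v | MemH1 v ∧ Integrable v volume ∧
    Integrable (fun x => |v x| ^ (p / 2)) volume ∧ ∫ x, |v x| ^ (p / 2) = 1}

/-- The distribution function `d_f(s) = |{x : |f x| > s}|`. -/
noncomputable def distribFun (f : ℝ → ℝ) (s : ℝ) : ENNReal :=
  volume {x : ℝ | s < |f x|}

/-- The non-increasing rearrangement `f*(t) = inf {s > 0 : d_f(s) ≤ t}`, for `t ≥ 0`.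
The set is non-empty whenever `f` is integrable and essentially bounded, in particular for every
`f ∈ H¹ ∩ L¹`. -/
noncomputable def decrRearr (f : ℝ → ℝ) (t : ℝ) : ℝ :=
  sInf {s : ℝ | 0 < s ∧ distribFun f s ≤ ENNReal.ofReal t}

/-- The symmetric rearrangement `f^#(x) = f*(2|x|)`. -/
noncomputable def symmRearr (f : ℝ → ℝ) (x : ℝ) : ℝ :=
  decrRearr f (2 * |x|)

/-- Bell-shaped: even, non-negative and non-increasing on `(0, ∞)`. -/
def BellShaped (f : ℝ → ℝ) : Prop :=
  (∀ x, f (-x) = f x) ∧ (∀ x, 0 ≤ f x) ∧ AntitoneOn f (Ioi 0)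

end Compacton

/-!
The minimizer is found in closed form, up to a quadrature, and no rearrangement inequality is needed.
Write `q = p / 2 > 1` and `K = ∫₀¹ √(t - t ^ q) dt`.

*Lower bound.* Let `v` be admissible with `A = sup |v|`. For `k(s) = √(ω s - ω A ^ (1 - q) s ^ q)`,
which is real for `0 ≤ s ≤ A`, the inequality `|v'|² / 4 + k(|v|)² ≥ k(|v|) |v'|` integrates to
`N₀[v] ≥ ω A ^ (1 - q) + ∫ k(|v|) |v'|`, thanks to the constraint. As `v` is integrable and
absolutely continuous, `|v|` climbs from `0` up to `A` and down again, so the last integral is at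
least `2 ∫₀ᴬ k = 2 √(ω A) A K` (`two_mul_integral_le_integral_comp_abs`,
`exists_le_energy_of_primitive`). Hence `N₀[v] ≥ h(A)` with
`h(A) = ω A ^ (1 - q) + 2 K √(ω A) A`, a function of one variable with a unique minimum.

*Equality.* The pointwise inequality is an equality when `|φ'| = 2 k(|φ|)`. After scaling this is
`ψ' = -2 √(ψ - ψ ^ q)` on `(0, L)`, which is solved by inverting the primitive of
`1 / (2 √(t - t ^ q))`. That function has inverse square root singularities at `0` and `1`, so
`ψ` descends from `1` to `0` in finite time (`exists_isProfile`). With the height `A` fixed by the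
constraint, the candidate is `φ(x) = A ψ(√(ω / A) x)`, whose energy is `h(A)`. This `A` is the
minimum point of `h` because of the identity `3 K = (q - 1) ∫ ψ ^ q`, obtained by integrating
`(ψ ψ')'` (`IsProfile.integral_eq`, `one_add_le_rpow_add`).

Being continuous, even and antitone on `[0, ∞)`, `φ` is its own symmetric rearrangement
(`symmRearr_eq_self`).
-/

/-! ### Primitives and weak derivatives -/

namespace Compacton

section Primitive

variable {f g : ℝ → ℝ}

theorem intervalIntegrable_of_locallyIntegrable (hg : LocallyIntegrable g volume) (a b : ℝ) :
    IntervalIntegrable g volume a b :=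
  (hg.integrableOn_isCompact isCompact_uIcc).intervalIntegrable

theorem absolutelyContinuousOnInterval_of_primitive (hg : LocallyIntegrable g volume)
    (hf : ∀ x, f x = f 0 + ∫ t in (0 : ℝ)..x, g t) (a b : ℝ) :
    AbsolutelyContinuousOnInterval f a b := by
  have hi : ∀ a b, IntervalIntegrable g volume a b := intervalIntegrable_of_locallyIntegrable hg
  have h1 : AbsolutelyContinuousOnInterval (fun x => ∫ t in a..x, g t) a b :=
    (hi a b).absolutelyContinuousOnInterval_intervalIntegral left_mem_uIcc
  have h2 : AbsolutelyContinuousOnInterval (fun _ : ℝ => f a) a b :=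
    (contDiffOn_const (c := f a)).absolutelyContinuousOnInterval
  have h3 : f = (fun _ : ℝ => f a) + fun x => ∫ t in a..x, g t := by
    funext x
    have := intervalIntegral.integral_interval_sub_left (hi 0 x) (hi 0 a)
    simp only [Pi.add_apply]
    linarith [hf x, hf a]
  rw [h3]
  exact h2.add h1

theorem ae_hasDerivAt_of_primitive (hg : LocallyIntegrable g volume)
    (hf : ∀ x, f x = f 0 + ∫ t in (0 : ℝ)..x, g t) : ∀ᵐ x, HasDerivAt f (g x) x := by
  filter_upwards [LocallyIntegrable.ae_hasDerivAt_integral hg] with x hx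
  have h := (hx 0).const_add (f 0)
  rwa [← funext hf] at h

theorem continuous_of_primitive (hg : LocallyIntegrable g volume)
    (hf : ∀ x, f x = f 0 + ∫ t in (0 : ℝ)..x, g t) : Continuous f := by
  have h := intervalIntegral.continuous_primitive
    (intervalIntegrable_of_locallyIntegrable hg) 0
  rw [funext hf]
  exact continuous_const.add h

theorem exists_tsupport_subset_Ioo {η : ℝ → ℝ} (hc : HasCompactSupport η) :
    ∃ R, tsupport η ⊆ Ioo (-R) R := by
  obtain ⟨R, hR⟩ := hc.isCompact.isBounded.subset_ball 0
  refine ⟨R, fun x hx => ?_⟩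
  have h := hR hx
  rw [Metric.mem_ball, dist_zero_right, Real.norm_eq_abs] at h
  exact abs_lt.1 h

/-- Integration by parts: a primitive of `g` has weak derivative `g`. -/
theorem isWeakDeriv_of_primitive (hg : LocallyIntegrable g volume)
    (hf : ∀ x, f x = f 0 + ∫ t in (0 : ℝ)..x, g t) : IsWeakDeriv f g := by
  refine ⟨(continuous_of_primitive hg hf).locallyIntegrable, hg, fun η hη hc => ?_⟩
  obtain ⟨R, hR⟩ := exists_tsupport_subset_Ioo hc
  have hsub : ∀ k : ℝ → ℝ, Function.support k ⊆ tsupport η → Function.support k ⊆ Ioc (-R) R :=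
    fun k hk => (hk.trans hR).trans Ioo_subset_Ioc_self
  have hout : ∀ x, x ∉ Ioo (-R) R → η x = 0 := fun x hx => image_eq_zero_of_notMem_tsupport
    fun h => hx (hR h)
  have hηac : AbsolutelyContinuousOnInterval η (-R) R :=
    (hη.of_le (by exact_mod_cast le_top)).contDiffOn.absolutelyContinuousOnInterval
  have h := (absolutelyContinuousOnInterval_of_primitive hg hf
    (-R) R).integral_mul_deriv_eq_deriv_mul hηac
  rw [hout R (by simp), hout (-R) (by simp)] at h
  have h1 : ∫ x in (-R)..R, deriv f x * η x = ∫ x in (-R)..R, g x * η x := by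
    apply intervalIntegral.integral_congr_ae
    filter_upwards [ae_hasDerivAt_of_primitive hg hf] with x hx _
    rw [hx.deriv]
  rw [h1, intervalIntegral.integral_eq_integral_of_support_subset,
    intervalIntegral.integral_eq_integral_of_support_subset] at h
  · simpa using h
  · exact hsub _ ((Function.support_mul_subset_right _ _).trans (subset_tsupport η))
  · refine hsub _ ((Function.support_mul_subset_right _ _).trans ?_)
    exact support_deriv_subset

/-- A locally integrable function whose weak derivative vanishes is constant. -/
theorem ae_eq_const_of_integral_mul_deriv_eq_zero (hf : LocallyIntegrable f volume)
    (h : ∀ η : ℝ → ℝ, ContDiff ℝ (⊤ : ℕ∞) η → HasCompactSupport η →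
      ∫ x, f x * deriv η x = 0) : ∃ c, f =ᵐ[volume] fun _ => c := by
  let ρ : ℝ → ℝ := (default : ContDiffBump (0 : ℝ)).normed volume
  have hρs : ContDiff ℝ (⊤ : ℕ∞) ρ := ContDiffBump.contDiff_normed _
  have hρc : HasCompactSupport ρ := ContDiffBump.hasCompactSupport_normed _
  have hρ1 : ∫ x, ρ x = 1 := ContDiffBump.integral_normed _
  refine ⟨∫ x, ρ x * f x, ?_⟩
  refine ae_eq_of_integral_contDiff_smul_eq hf (locallyIntegrable_const _) fun η hη hc => ?_
  -- `η - (∫ η) ρ` has integral zero, so it is the derivative of a test function.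
  let k : ℝ → ℝ := fun x => η x - (∫ y, η y) * ρ x
  have hks : ContDiff ℝ (⊤ : ℕ∞) k := hη.sub (contDiff_const.mul hρs)
  have hkc : HasCompactSupport k := hc.sub hρc.mul_left
  have hiη := hη.continuous.integrable_of_hasCompactSupport (μ := volume) hc
  have hiρ := hρs.continuous.integrable_of_hasCompactSupport (μ := volume) hρc
  have hk0 : ∫ x, k x = 0 := by
    simp only [k]
    rw [integral_sub hiη (hiρ.const_mul _), integral_const_mul, hρ1]
    ring
  obtain ⟨R, hR⟩ := exists_tsupport_subset_Ioo hkc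
  have hout : ∀ x, x ∉ Ioo (-R) R → k x = 0 := fun x hx => image_eq_zero_of_notMem_tsupport
    fun h => hx (hR h)
  let θ : ℝ → ℝ := fun x => ∫ t in (-R)..x, k t
  have hθd : ∀ x, HasDerivAt θ (k x) x := fun x =>
    intervalIntegral.integral_hasDerivAt_right (hks.continuous.intervalIntegrable _ _)
      hks.continuous.stronglyMeasurable.stronglyMeasurableAtFilter hks.continuous.continuousAt
  have hθd' : deriv θ = k := funext fun x => (hθd x).deriv
  have hθs : ContDiff ℝ (⊤ : ℕ∞) θ := by
    rw [contDiff_infty_iff_deriv, hθd']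
    exact ⟨fun x => (hθd x).differentiableAt, hks⟩
  have hθc : HasCompactSupport θ := by
    refine HasCompactSupport.intro (isCompact_Icc (a := -R) (b := R)) fun x hx => ?_
    rw [mem_Icc, not_and_or, not_le, not_le] at hx
    rcases hx with hx | hx
    · refine intervalIntegral.integral_zero_ae (Filter.Eventually.of_forall fun t ht => ?_)
      rw [uIoc_of_ge hx.le] at ht
      exact hout t fun h => absurd ht.2 (not_le.2 h.1)
    · change ∫ t in (-R)..x, k t = 0
      rw [intervalIntegral.integral_eq_integral_of_support_subset, hk0]
      intro t ht
      by_contra hcon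
      exact ht (hout t fun h => hcon ⟨h.1, (h.2.trans hx).le⟩)
  have h0 := h θ hθs hθc
  rw [hθd'] at h0
  have hfη : Integrable (fun x => η x * f x) volume := by
    simpa using hf.integrable_smul_left_of_hasCompactSupport hη.continuous hc
  have hfρ : Integrable (fun x => ρ x * f x) volume := by
    simpa using hf.integrable_smul_left_of_hasCompactSupport hρs.continuous hρc
  have h1 : ∫ x, f x * k x = (∫ x, η x * f x) - (∫ y, η y) * ∫ x, ρ x * f x := by
    rw [← integral_const_mul, ← integral_sub hfη (hfρ.const_mul _)]
    congr 1
    funext x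
    simp only [k]
    ring
  simp only [smul_eq_mul]
  rw [integral_mul_const]
  linarith

/-- A function with a weak derivative `g` agrees almost everywhere with a primitive of `g`. -/
theorem IsWeakDeriv.exists_primitive (h : IsWeakDeriv f g) :
    ∃ F : ℝ → ℝ, f =ᵐ[volume] F ∧ ∀ x, F x = F 0 + ∫ t in (0 : ℝ)..x, g t := by
  let w : ℝ → ℝ := fun x => ∫ t in (0 : ℝ)..x, g t
  have hw : ∀ x, w x = w 0 + ∫ t in (0 : ℝ)..x, g t := fun x => by simp [w]
  have hW := isWeakDeriv_of_primitive h.2.1 hw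
  obtain ⟨c, hc⟩ := ae_eq_const_of_integral_mul_deriv_eq_zero (h.1.sub hW.1) fun η hη hs => by
    have hd : Continuous (deriv η) := hη.continuous_deriv (by simp)
    have h1 : Integrable (fun x => f x * deriv η x) volume := by
      simpa using h.1.integrable_smul_right_of_hasCompactSupport hd hs.deriv
    have h2 : Integrable (fun x => w x * deriv η x) volume := by
      simpa using hW.1.integrable_smul_right_of_hasCompactSupport hd hs.deriv
    simp only [Pi.sub_apply, sub_mul]
    rw [integral_sub h1 h2, h.2.2 η hη hs, hW.2.2 η hη hs]
    ring
  refine ⟨fun x => c + w x, ?_, fun x => by simp [w]⟩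
  filter_upwards [hc] with x hx
  simp only [Pi.sub_apply] at hx
  linarith

end Primitive

theorem _root_.LipschitzOnWith.comp_absolutelyContinuousOnInterval {K : NNReal} {s : Set ℝ}
    {G f : ℝ → ℝ} {a b : ℝ} (hG : LipschitzOnWith K G s)
    (hf : AbsolutelyContinuousOnInterval f a b) (hs : MapsTo f (uIcc a b) s) :
    AbsolutelyContinuousOnInterval (G ∘ f) a b := by
  rw [absolutelyContinuousOnInterval_iff] at hf ⊢
  intro ε hε
  obtain ⟨δ, hδ, h⟩ := hf (ε / (K + 1)) (by positivity)
  refine ⟨δ, hδ, fun E hE hlt => ?_⟩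
  calc ∑ i ∈ Finset.range E.1, dist ((G ∘ f) (E.2 i).1) ((G ∘ f) (E.2 i).2)
      ≤ ∑ i ∈ Finset.range E.1, (K + 1) * dist (f (E.2 i).1) (f (E.2 i).2) := by
        refine Finset.sum_le_sum fun i hi => ?_
        have hm := hE.1 i hi
        refine (hG.dist_le_mul _ (hs hm.1) _ (hs hm.2)).trans ?_
        gcongr
        linarith
    _ = (K + 1) * ∑ i ∈ Finset.range E.1, dist (f (E.2 i).1) (f (E.2 i).2) := by
        rw [Finset.mul_sum]
    _ < (K + 1) * (ε / (K + 1)) := by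
        gcongr
        exact h E hE hlt
    _ = ε := by field_simp

/-- The chain rule for a `C¹` function of an absolutely continuous one, in integrated form. -/
theorem integral_comp_primitive_mul {F g κ : ℝ → ℝ} (hg : LocallyIntegrable g volume)
    (hF : ∀ x, F x = F 0 + ∫ t in (0 : ℝ)..x, g t) (hκ : Continuous κ) (a b : ℝ) :
    ∫ x in a..b, κ (F x) * g x = (∫ s in (0 : ℝ)..F b, κ s) - ∫ s in (0 : ℝ)..F a, κ s := by
  let H : ℝ → ℝ := fun y => ∫ s in (0 : ℝ)..y, κ s
  have hH : ∀ y, HasDerivAt H (κ y) y := fun y =>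
    intervalIntegral.integral_hasDerivAt_right (hκ.intervalIntegrable _ _)
      hκ.stronglyMeasurable.stronglyMeasurableAtFilter hκ.continuousAt
  have hHs : ContDiff ℝ 1 H := by
    rw [contDiff_one_iff_deriv, show deriv H = κ from funext fun y => (hH y).deriv]
    exact ⟨fun y => (hH y).differentiableAt, hκ⟩
  have hFac := absolutelyContinuousOnInterval_of_primitive hg hF a b
  obtain ⟨C, hC⟩ := hFac.exists_bound
  obtain ⟨K, hK⟩ := hHs.contDiffOn.exists_lipschitzOnWith (s := Icc (-C) C) one_ne_zero
    (convex_Icc _ _) isCompact_Icc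
  have hac := hK.comp_absolutelyContinuousOnInterval hFac fun x hx => abs_le.1 (hC x hx)
  have h := hac.integral_deriv_eq_sub
  rw [Function.comp_apply, Function.comp_apply] at h
  rw [← h]
  apply intervalIntegral.integral_congr_ae
  filter_upwards [ae_hasDerivAt_of_primitive hg hF] with x hx _
  exact (((hH (F x)).comp x hx).deriv).symm

end Compacton

/-! ### The lower bound in terms of the maximum -/

namespace Compacton

theorem exists_abs_lt_of_integrableOn {F : ℝ → ℝ} {s : Set ℝ} (hF : IntegrableOn F s volume)
    (hs : MeasurableSet s) (hs' : volume s = ⊤) {ε : ℝ} (hε : 0 < ε) : ∃ y ∈ s, |F y| < ε := by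
  by_contra! hcon
  have h : IntegrableOn (fun _ : ℝ => ε) s volume := by
    refine Integrable.mono' hF.abs aestronglyMeasurable_const ?_
    filter_upwards [ae_restrict_mem hs] with y hy
    rw [Real.norm_eq_abs, abs_of_pos hε]
    exact hcon y hy
  rw [integrableOn_const_iff] at h
  rcases h with h | h
  · exact hε.ne' (enorm_eq_zero.1 h)
  · exact h.ne hs'

theorem abs_integral_comp_abs (k : ℝ → ℝ) (hk : ∀ s, 0 ≤ k s) (y : ℝ) :
    |∫ s in (0 : ℝ)..y, k (|s|)| = ∫ s in (0 : ℝ)..|y|, k s := by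
  have key : ∀ z : ℝ, 0 ≤ z → ∫ s in (0 : ℝ)..z, k |s| = ∫ s in (0 : ℝ)..z, k s := fun z hz =>
    intervalIntegral.integral_congr fun s hs => by
      rw [uIcc_of_le hz] at hs
      simp only [abs_of_nonneg hs.1]
  have hnn : ∀ z : ℝ, 0 ≤ z → 0 ≤ ∫ s in (0 : ℝ)..z, k s := fun z hz =>
    intervalIntegral.integral_nonneg hz fun s _ => hk s
  rcases le_total 0 y with hy | hy
  · rw [key y hy, abs_of_nonneg hy, abs_of_nonneg (hnn y hy)]
  · have h1 := intervalIntegral.integral_comp_neg (a := 0) (b := y) fun s => k |s|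
    simp only [abs_neg, neg_zero] at h1
    rw [h1, intervalIntegral.integral_symm, abs_neg, key _ (neg_nonneg.2 hy), abs_of_nonpos hy,
      abs_of_nonneg (hnn _ (neg_nonneg.2 hy))]

/-- The graph of an integrable function rises to each of its values from `0` and returns to `0`,
so the weighted variation of `F` counts every level below `|F x|` twice. -/
theorem two_mul_integral_le_integral_comp_abs {F g k : ℝ → ℝ} (hg : LocallyIntegrable g volume)
    (hF : ∀ x, F x = F 0 + ∫ t in (0 : ℝ)..x, g t) (hFi : Integrable F volume)
    (hk : Continuous k) (hk0 : ∀ s, 0 ≤ k s)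
    (hi : Integrable (fun x => k |F x| * |g x|) volume) (x : ℝ) :
    2 * ∫ s in (0 : ℝ)..|F x|, k s ≤ ∫ y, k |F y| * |g y| := by
  have hka : Continuous fun s => k |s| := hk.comp continuous_abs
  let H : ℝ → ℝ := fun y => ∫ s in (0 : ℝ)..y, k |s|
  have hHc : Continuous H := intervalIntegral.continuous_primitive
    (fun a b => hka.intervalIntegrable a b) 0
  have hH0 : H 0 = 0 := by simp [H]
  rw [← abs_integral_comp_abs k hk0]
  have hb : ∀ a b, a ≤ b → |H (F b) - H (F a)| ≤ ∫ y in Ioc a b, k |F y| * |g y| := by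
    intro a b hab
    rw [← integral_comp_primitive_mul hg hF hka a b, intervalIntegral.integral_of_le hab]
    refine (abs_integral_le_integral_abs).trans (le_of_eq ?_)
    congr 1
    funext y
    rw [abs_mul, abs_of_nonneg (hk0 _)]
  refine le_of_forall_pos_le_add fun ε hε => ?_
  obtain ⟨δ, hδ, hHδ⟩ := Metric.continuous_iff.1 hHc 0 (ε / 2) (by positivity)
  have hsmall : ∀ y, |F y| < δ → |H (F y)| < ε / 2 := fun y hy => by
    simpa [hH0] using hHδ (F y) (by simpa using hy)
  obtain ⟨a, ha, hFa⟩ := exists_abs_lt_of_integrableOn (s := Iio x) hFi.integrableOn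
    measurableSet_Iio Real.volume_Iio hδ
  obtain ⟨b, hb', hFb⟩ := exists_abs_lt_of_integrableOn (s := Ioi x) hFi.integrableOn
    measurableSet_Ioi Real.volume_Ioi hδ
  have h1 := hb a x (le_of_lt ha)
  have h2 := hb x b (le_of_lt hb')
  have h3 : (∫ y in Ioc a x, k |F y| * |g y|) + ∫ y in Ioc x b, k |F y| * |g y|
      ≤ ∫ y, k |F y| * |g y| := by
    rw [← setIntegral_union (Ioc_disjoint_Ioc_of_le le_rfl) measurableSet_Ioc hi.integrableOn
      hi.integrableOn]
    exact setIntegral_le_integral hi (Filter.Eventually.of_forall fun y =>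
      mul_nonneg (hk0 _) (abs_nonneg _))
  have h4 := abs_sub_abs_le_abs_sub (H (F x)) (H (F a))
  have h5 := abs_sub_abs_le_abs_sub (H (F x)) (H (F b))
  rw [abs_sub_comm] at h2
  have h6 := hsmall a hFa
  have h7 := hsmall b hFb
  change 2 * |H (F x)| ≤ _
  linarith

/-- The weight `√(t - t ^ q)` whose integral over `(0, 1)` enters the sharp lower bound. -/
noncomputable def weight (q t : ℝ) : ℝ := √(t - t ^ q)

theorem weight_nonneg (q t : ℝ) : 0 ≤ weight q t := Real.sqrt_nonneg _

theorem continuous_weight {q : ℝ} (hq : 1 < q) : Continuous (weight q) :=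
  (continuous_id.sub (Real.continuous_rpow_const (by linarith))).sqrt

theorem rpow_le_self {q t : ℝ} (hq : 1 < q) (h0 : 0 ≤ t) (h1 : t ≤ 1) : t ^ q ≤ t := by
  simpa using Real.rpow_le_rpow_of_exponent_ge' h0 h1 zero_le_one hq.le

theorem weight_sq {q t : ℝ} (hq : 1 < q) (h0 : 0 ≤ t) (h1 : t ≤ 1) :
    weight q t ^ 2 = t - t ^ q :=
  Real.sq_sqrt (sub_nonneg.2 (rpow_le_self hq h0 h1))

/-- Lower bound for the energy of `F` in terms of `A = sup |F|`. It comes from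
`|F'|² / 4 + k(|F|)² ≥ k(|F|) |F'|` with the weight `k(s) = √(ω s - ω A ^ (1 - q) s ^ q)`, which is
real on `[0, A]` and vanishes at `A`. -/
theorem exists_le_energy_of_primitive {F g : ℝ → ℝ} {q ω : ℝ} (hq : 1 < q) (hω : 0 < ω)
    (hg : LocallyIntegrable g volume)
    (hF : ∀ x, F x = F 0 + ∫ t in (0 : ℝ)..x, g t) (hFi : Integrable F volume)
    (hF2 : MemLp F 2 volume) (hg2 : MemLp g 2 volume)
    (hFq : Integrable (fun x => |F x| ^ q) volume) (h1 : ∫ x, |F x| ^ q = 1) :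
    ∃ A > 0, ω * A ^ (1 - q) + 2 * (√(ω * A) * A * ∫ t in (0 : ℝ)..1, weight q t) ≤
      (1 / 4) * (∫ x, |g x| ^ 2) + ω * ∫ x, |F x| := by
  have hFc := continuous_of_primitive hg hF
  have hgsq : Integrable (fun x => |g x| ^ 2) volume := by
    simpa only [sq_abs] using hg2.integrable_sq
  -- `F` is bounded.
  have hbd : ∀ x, |F x| ^ 2 ≤ ∫ y, |F y| * |g y| := by
    intro x
    have hi : Integrable (fun x => |(|F x|)| * |g x|) volume := by
      simpa only [abs_abs, Pi.mul_apply, abs_mul] using (hF2.integrable_mul hg2).abs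
    have h := two_mul_integral_le_integral_comp_abs hg hF hFi continuous_abs abs_nonneg hi x
    have h2 : ∫ s in (0 : ℝ)..|F x|, |s| = |F x| ^ 2 / 2 := by
      rw [intervalIntegral.integral_congr (g := fun s => s) fun s hs => by
        rw [uIcc_of_le (abs_nonneg _)] at hs
        exact abs_of_nonneg hs.1]
      simp
    simp only [abs_abs] at h
    linarith
  have hbdd : BddAbove (range fun x => |F x|) := by
    refine ⟨√(∫ y, |F y| * |g y|), ?_⟩
    rintro _ ⟨x, rfl⟩
    exact Real.le_sqrt_of_sq_le (hbd x)
  let A : ℝ := sSup (range fun x => |F x|)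
  have hFA : ∀ x, |F x| ≤ A := fun x => le_csSup hbdd ⟨x, rfl⟩
  have hA : 0 < A := by
    by_contra hcon
    have h0 : ∀ x, |F x| = 0 := fun x =>
      le_antisymm ((hFA x).trans (not_lt.1 hcon)) (abs_nonneg _)
    simp [h0, Real.zero_rpow (by linarith : q ≠ 0)] at h1
  refine ⟨A, hA, ?_⟩
  let k : ℝ → ℝ := fun s => √(ω * A) * weight q (s / A)
  have hkc : Continuous k := continuous_const.mul
    ((continuous_weight hq).comp (continuous_id.div_const A))
  have hk0 : ∀ s, 0 ≤ k s := fun s => mul_nonneg (Real.sqrt_nonneg _) (weight_nonneg _ _)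
  have hksq : ∀ s, 0 ≤ s → s ≤ A → k s ^ 2 = ω * s - ω * A ^ (1 - q) * s ^ q := by
    intro s hs hsA
    simp only [k]
    rw [mul_pow, Real.sq_sqrt (by positivity), weight_sq hq (by positivity)
      ((div_le_one hA).2 hsA), Real.div_rpow hs hA.le, Real.rpow_sub hA, Real.rpow_one]
    have := (Real.rpow_pos_of_pos hA q).ne'
    field_simp
  have hkF : ∀ x, k |F x| ^ 2 = ω * |F x| - ω * A ^ (1 - q) * |F x| ^ q := fun x =>
    hksq _ (abs_nonneg _) (hFA x)
  have hM : Integrable (fun x => ω * |F x| - ω * A ^ (1 - q) * |F x| ^ q) volume :=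
    (hFi.abs.const_mul _).sub (hFq.const_mul _)
  have hR : Integrable (fun x => (1 / 4) * |g x| ^ 2 +
      (ω * |F x| - ω * A ^ (1 - q) * |F x| ^ q)) volume :=
    (hgsq.const_mul _).add hM
  have hle : ∀ x, k |F x| * |g x| ≤ (1 / 4) * |g x| ^ 2 +
      (ω * |F x| - ω * A ^ (1 - q) * |F x| ^ q) := by
    intro x
    rw [← hkF]
    nlinarith [sq_nonneg (|g x| / 2 - k |F x|)]
  have hki : Integrable (fun x => k |F x| * |g x|) volume := by
    refine hR.mono' ?_ (Filter.Eventually.of_forall fun x => ?_)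
    · exact (hkc.comp hFc.abs).aestronglyMeasurable.mul hg2.1.norm
    · rw [Real.norm_eq_abs, abs_of_nonneg (mul_nonneg (hk0 _) (abs_nonneg _))]
      exact hle x
  have hint := integral_mono hki hR hle
  rw [integral_add (hgsq.const_mul _) hM,
    integral_sub (hFi.abs.const_mul _) (hFq.const_mul _), integral_const_mul, integral_const_mul,
    integral_const_mul, h1] at hint
  have hsup : A ∈ {y : ℝ | 2 * ∫ s in (0 : ℝ)..y, k s ≤ ∫ y, k |F y| * |g y|} := by
    refine closure_minimal ?_ ?_ (csSup_mem_closure (range_nonempty fun x => |F x|) hbdd)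
    · rintro _ ⟨x, rfl⟩
      exact two_mul_integral_le_integral_comp_abs hg hF hFi hkc hk0 hki x
    · exact isClosed_le (continuous_const.mul (intervalIntegral.continuous_primitive
        (fun a b => hkc.intervalIntegrable a b) 0)) continuous_const
  have hkA : ∫ s in (0 : ℝ)..A, k s = √(ω * A) * A * ∫ t in (0 : ℝ)..1, weight q t := by
    simp only [k]
    rw [intervalIntegral.integral_const_mul, intervalIntegral.integral_comp_div _ hA.ne',
      zero_div, div_self hA.ne', smul_eq_mul, mul_assoc]
  rw [mem_ofPred_eq, hkA] at hsup
  linarith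

end Compacton

/-! ### The normalized profile -/

namespace Compacton

/-- `ψ` is an even bump of height `1` supported in `[-L, L]` that solves
`ψ' = -2 √(ψ - ψ ^ q)` on `(0, L)`. -/
structure IsProfile (q L : ℝ) (ψ : ℝ → ℝ) : Prop where
  length_pos : 0 < L
  continuous : Continuous ψ
  even : ∀ x, ψ (-x) = ψ x
  antitoneOn : AntitoneOn ψ (Ici 0)
  nonneg : ∀ x, 0 ≤ ψ x
  le_one : ∀ x, ψ x ≤ 1
  apply_zero : ψ 0 = 1
  eq_zero : ∀ x, L ≤ |x| → ψ x = 0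
  mem_Ioo : ∀ x ∈ Ioo 0 L, ψ x ∈ Ioo (0 : ℝ) 1
  hasDerivAt : ∀ x ∈ Ioo 0 L, HasDerivAt ψ (-(2 * weight q (ψ x))) x

theorem min_mul_le_sub_rpow {q t : ℝ} (hq : 1 < q) (h0 : 0 < t) (h1 : t < 1) :
    min 1 (q - 1) * (t * (1 - t)) ≤ t - t ^ q := by
  have h2 : t ^ q = t * t ^ (q - 1) := by
    rw [Real.rpow_sub_one h0.ne', mul_div_cancel₀ _ h0.ne']
  have h3 : min 1 (q - 1) * (1 - t) ≤ 1 - t ^ (q - 1) := by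
    rcases le_total 1 (q - 1) with h | h
    · rw [min_eq_left h]
      have := Real.rpow_le_rpow_of_exponent_ge h0 h1.le h
      rw [Real.rpow_one] at this
      linarith
    · rw [min_eq_right h]
      have := rpow_one_add_le_one_add_mul_self (s := t - 1) (p := q - 1) (by linarith)
        (by linarith) h
      rw [add_sub_cancel] at this
      linarith
  rw [h2]
  nlinarith

theorem weight_pos {q t : ℝ} (hq : 1 < q) (h0 : 0 < t) (h1 : t < 1) : 0 < weight q t := by
  refine Real.sqrt_pos.2 (lt_of_lt_of_le ?_ (min_mul_le_sub_rpow hq h0 h1))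
  have : 0 < min 1 (q - 1) := lt_min one_pos (by linarith)
  have : 0 < 1 - t := by linarith
  positivity

theorem inv_weight_le {q t : ℝ} (hq : 1 < q) (h0 : 0 < t) (h1 : t < 1) :
    (weight q t)⁻¹ ≤
      (√(min 1 (q - 1)))⁻¹ * (t ^ (-(1 / 2) : ℝ) + (1 - t) ^ (-(1 / 2) : ℝ)) := by
  have hc : 0 < min 1 (q - 1) := lt_min one_pos (by linarith)
  have h1' : 0 < 1 - t := by linarith
  have hs := Real.sqrt_pos.2 h0
  have hs' := Real.sqrt_pos.2 h1'
  have hs2 := Real.sq_sqrt h0.le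
  have hs2' := Real.sq_sqrt h1'.le
  have hle : √(min 1 (q - 1)) * (√t * √(1 - t)) ≤ weight q t := by
    rw [← Real.sqrt_mul h0.le, ← Real.sqrt_mul hc.le]
    exact Real.sqrt_le_sqrt (min_mul_le_sub_rpow hq h0 h1)
  rw [Real.rpow_neg h0.le, Real.rpow_neg h1'.le, ← Real.sqrt_eq_rpow, ← Real.sqrt_eq_rpow]
  have hpos : 0 < √(min 1 (q - 1)) := Real.sqrt_pos.2 hc
  calc (weight q t)⁻¹ ≤ (√(min 1 (q - 1)) * (√t * √(1 - t)))⁻¹ :=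
        inv_anti₀ (by positivity) hle
    _ = (√(min 1 (q - 1)))⁻¹ * (√t * √(1 - t))⁻¹ := mul_inv _ _
    _ ≤ _ := by
        gcongr
        rw [inv_add_inv hs.ne' hs'.ne', inv_eq_one_div]
        gcongr
        -- `√t ≤ 1` and `√(1 - t) ≤ 1`, so their sum is at least the sum of their squares
        have : √t ≤ 1 := Real.sqrt_le_one.2 h1.le
        have : √(1 - t) ≤ 1 := Real.sqrt_le_one.2 (by linarith)
        nlinarith

/-- The reciprocal speed of the profile, extended by `1` outside `(0, 1)` so that its primitive is
an increasing bijection of `ℝ`. -/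
noncomputable def slowness (q : ℝ) : ℝ → ℝ :=
  (Ioo (0 : ℝ) 1).piecewise (fun t => (2 * weight q t)⁻¹) fun _ => 1

theorem slowness_of_mem {q t : ℝ} (ht : t ∈ Ioo (0 : ℝ) 1) :
    slowness q t = (2 * weight q t)⁻¹ := piecewise_eq_of_mem _ _ _ ht

theorem slowness_of_notMem {q t : ℝ} (ht : t ∉ Ioo (0 : ℝ) 1) : slowness q t = 1 :=
  piecewise_eq_of_notMem _ _ _ ht

theorem slowness_pos {q : ℝ} (hq : 1 < q) (t : ℝ) : 0 < slowness q t := by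
  by_cases ht : t ∈ Ioo (0 : ℝ) 1
  · rw [slowness_of_mem ht]
    have := weight_pos hq ht.1 ht.2
    positivity
  · rw [slowness_of_notMem ht]
    exact one_pos

theorem measurable_slowness {q : ℝ} (hq : 1 < q) : Measurable (slowness q) :=
  Measurable.piecewise measurableSet_Ioo
    ((continuous_weight hq).measurable.const_mul 2).inv measurable_const

/-- The singularities of the slowness at `0` and `1` are of inverse square root type. -/
theorem intervalIntegrable_slowness {q : ℝ} (hq : 1 < q) (a b : ℝ) :
    IntervalIntegrable (slowness q) volume a b := by
  let C : ℝ := (√(min 1 (q - 1)))⁻¹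
  have hC : 0 ≤ C := by positivity
  have h1 : ∀ a b, IntervalIntegrable (fun t : ℝ => t ^ (-(1 / 2) : ℝ)) volume a b := fun a b =>
    intervalIntegral.intervalIntegrable_rpow' (by norm_num)
  have h2 : IntervalIntegrable (fun t : ℝ => (1 - t) ^ (-(1 / 2) : ℝ)) volume a b := by
    simpa using (h1 (1 - a) (1 - b)).comp_sub_left 1
  have h3 : IntervalIntegrable (fun t : ℝ => 1 + C * (|t ^ (-(1 / 2) : ℝ)| +
      |(1 - t) ^ (-(1 / 2) : ℝ)|)) volume a b :=
    intervalIntegrable_const.add (((h1 a b).abs.add h2.abs).const_mul C)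
  refine h3.mono_fun (measurable_slowness hq).aestronglyMeasurable
    (Filter.Eventually.of_forall fun t => ?_)
  have hnn : 0 ≤ C * (|t ^ (-(1 / 2) : ℝ)| + |(1 - t) ^ (-(1 / 2) : ℝ)|) := by positivity
  simp only [Real.norm_eq_abs]
  rw [abs_of_pos (slowness_pos hq t), abs_of_nonneg (by linarith)]
  by_cases ht : t ∈ Ioo (0 : ℝ) 1
  · rw [slowness_of_mem ht, mul_inv]
    have h4 := inv_weight_le hq ht.1 ht.2
    have h5 : C * (t ^ (-(1 / 2) : ℝ) + (1 - t) ^ (-(1 / 2) : ℝ)) ≤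
        C * (|t ^ (-(1 / 2) : ℝ)| + |(1 - t) ^ (-(1 / 2) : ℝ)|) := by
      gcongr <;> exact le_abs_self _
    have h6 : 0 < (weight q t)⁻¹ := inv_pos.2 (weight_pos hq ht.1 ht.2)
    linarith
  · rw [slowness_of_notMem ht]
    linarith

/-- The profile is the inverse function of the primitive of the slowness, reflected. -/
theorem exists_isProfile {q : ℝ} (hq : 1 < q) : ∃ L ψ, IsProfile q L ψ := by
  have hi := intervalIntegrable_slowness hq
  let Y : ℝ → ℝ := fun s => ∫ t in (0 : ℝ)..s, slowness q t
  have hY0 : Y 0 = 0 := by simp [Y]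
  have hYsub : ∀ a b, Y b - Y a = ∫ t in a..b, slowness q t := fun a b =>
    intervalIntegral.integral_interval_sub_left (hi 0 b) (hi 0 a)
  have hYc : Continuous Y := intervalIntegral.continuous_primitive hi 0
  have hYm : StrictMono Y := fun a b hab => by
    have := intervalIntegral.intervalIntegral_pos_of_pos (hi a b) (slowness_pos hq) hab
    linarith [hYsub a b]
  have hYneg : ∀ s ≤ 0, Y s = s := fun s hs => by
    have h : ∫ t in (0 : ℝ)..s, slowness q t = ∫ t in (0 : ℝ)..s, (1 : ℝ) := by
      refine intervalIntegral.integral_congr fun t ht => ?_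
      rw [uIcc_of_ge hs] at ht
      exact slowness_of_notMem fun h => absurd ht.2 (not_le.2 h.1)
    simpa using h
  have hYbig : ∀ s, 1 ≤ s → Y s = Y 1 + (s - 1) := fun s hs => by
    have h : ∫ t in (1 : ℝ)..s, slowness q t = ∫ t in (1 : ℝ)..s, (1 : ℝ) := by
      refine intervalIntegral.integral_congr fun t ht => ?_
      rw [uIcc_of_le hs] at ht
      exact slowness_of_notMem fun h => absurd ht.1 (not_le.2 h.2)
    rw [← hYsub] at h
    simp only [intervalIntegral.integral_const, smul_eq_mul, mul_one] at h
    linarith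
  have hYs : Function.Surjective Y := by
    refine hYc.surjective ?_ ?_
    · refine Filter.Tendsto.congr' (f₁ := fun s => Y 1 + (s - 1)) ?_ ?_
      · filter_upwards [Filter.eventually_ge_atTop (1 : ℝ)] with s hs
        exact (hYbig s hs).symm
      · exact Filter.tendsto_atTop_add_const_left _ _
          (Filter.tendsto_atTop_add_const_right _ _ Filter.tendsto_id)
    · refine Filter.Tendsto.congr' (f₁ := fun s => s) ?_ Filter.tendsto_id
      filter_upwards [Filter.eventually_le_atBot (0 : ℝ)] with s hs
      exact (hYneg s hs).symm
  let e := hYm.orderIsoOfSurjective Y hYs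
  have heY : ∀ y, Y (e.symm y) = y := fun y => e.apply_symm_apply y
  have heY' : ∀ s, e.symm (Y s) = s := fun s => e.symm_apply_apply s
  have hec : Continuous e.symm := e.symm.continuous
  have he0 : e.symm 0 = 0 := by rw [← hY0, heY', hY0]
  have hed : ∀ y ∈ Ioo 0 (Y 1), e.symm y ∈ Ioo (0 : ℝ) 1 ∧
      HasDerivAt e.symm (2 * weight q (e.symm y)) y := by
    intro y hy
    have hm : e.symm y ∈ Ioo (0 : ℝ) 1 := by
      constructor
      · rw [← he0]; exact e.symm.strictMono hy.1
      · rw [← heY' 1]; exact e.symm.strictMono hy.2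
    refine ⟨hm, ?_⟩
    have hw := weight_pos hq hm.1 hm.2
    have hev : slowness q =ᶠ[nhds (e.symm y)] fun t => (2 * weight q t)⁻¹ := by
      filter_upwards [Ioo_mem_nhds hm.1 hm.2] with t ht
      exact slowness_of_mem ht
    have hca : ContinuousAt (slowness q) (e.symm y) := by
      refine ContinuousAt.congr ?_ hev.symm
      exact ((continuous_const.mul (continuous_weight hq)).continuousAt).inv₀
        (mul_ne_zero two_ne_zero hw.ne')
    have hYd : HasDerivAt Y (slowness q (e.symm y)) (e.symm y) :=
      intervalIntegral.integral_hasDerivAt_right (hi _ _)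
        (measurable_slowness hq).stronglyMeasurable.stronglyMeasurableAtFilter hca
    have h := HasDerivAt.of_local_left_inverse hec.continuousAt hYd (slowness_pos hq _).ne'
      (Filter.Eventually.of_forall heY)
    rwa [slowness_of_mem hm, inv_inv] at h
  have hL : 0 < Y 1 := by rw [← hY0]; exact hYm one_pos
  refine ⟨Y 1, fun x => max (e.symm (Y 1 - |x|)) 0, hL, by fun_prop, fun x => by simp,
    fun x hx y hy hxy => ?_, fun x => le_max_right _ _, fun x => max_le ?_ zero_le_one, ?_,
    fun x hx => ?_, fun x hx => ?_, fun x hx => ?_⟩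
  · rw [mem_Ici] at hx hy
    refine max_le_max_right 0 (e.symm.monotone ?_)
    rw [abs_of_nonneg hx, abs_of_nonneg hy]
    linarith
  · refine (e.symm.monotone (by linarith [abs_nonneg x] : Y 1 - |x| ≤ Y 1)).trans ?_
    rw [heY']
  · simp [heY']
  · refine max_eq_right ?_
    rw [← he0]
    exact e.symm.monotone (by linarith)
  · have h := (hed (Y 1 - x) ⟨by linarith [hx.2], by linarith [hx.1]⟩).1
    simp only [abs_of_pos hx.1]
    rwa [max_eq_left h.1.le]
  · obtain ⟨h, hd⟩ := hed (Y 1 - x) ⟨by linarith [hx.2], by linarith [hx.1]⟩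
    have hev : (fun x => max (e.symm (Y 1 - |x|)) 0) =ᶠ[nhds x] fun x => e.symm (Y 1 - x) := by
      filter_upwards [Ioo_mem_nhds hx.1 hx.2] with z hz
      have h' := (hed (Y 1 - z) ⟨by linarith [hz.2], by linarith [hz.1]⟩).1
      rw [abs_of_pos hz.1, max_eq_left h'.1.le]
    have hx' := hev.eq_of_nhds
    beta_reduce at hx'
    rw [hx']
    refine HasDerivAt.congr_of_eventuallyEq ?_ hev
    exact (hd.comp x ((hasDerivAt_id x).const_sub (Y 1))).congr_deriv (by simp)

namespace IsProfile

variable {q L : ℝ} {ψ : ℝ → ℝ}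

theorem apply_abs (h : IsProfile q L ψ) (x : ℝ) : ψ |x| = ψ x := by
  rcases abs_choice x with hx | hx <;> rw [hx]
  exact h.even x

theorem weight_sq (h : IsProfile q L ψ) (hq : 1 < q) (x : ℝ) :
    weight q (ψ x) ^ 2 = ψ x - ψ x ^ q :=
  Compacton.weight_sq hq (h.nonneg x) (h.le_one x)

theorem hasCompactSupport_comp (h : IsProfile q L ψ) {k : ℝ → ℝ} (hk : k 0 = 0) :
    HasCompactSupport fun x => k (ψ x) := by
  refine HasCompactSupport.intro (isCompact_Icc (a := -L) (b := L)) fun x hx => ?_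
  rw [h.eq_zero x, hk]
  by_contra! hcon
  exact hx (abs_le.1 hcon.le)

theorem integrable_comp (h : IsProfile q L ψ) {k : ℝ → ℝ} (hc : Continuous k) (hk : k 0 = 0) :
    Integrable (fun x => k (ψ x)) volume :=
  (hc.comp h.continuous).integrable_of_hasCompactSupport (h.hasCompactSupport_comp hk)

theorem integral_comp (h : IsProfile q L ψ) {k : ℝ → ℝ} (hk : k 0 = 0) :
    ∫ x, k (ψ x) = 2 * ∫ x in (0 : ℝ)..L, k (ψ x) := by
  have h1 := integral_comp_abs (f := fun x => k (ψ x))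
  simp only [h.apply_abs] at h1
  rw [h1, intervalIntegral.integral_of_le h.length_pos.le]
  congr 1
  refine setIntegral_eq_of_subset_of_forall_sdiff_eq_zero measurableSet_Ioi Ioc_subset_Ioi_self
    fun x hx => ?_
  have hx0 : 0 < x := hx.1
  rw [h.eq_zero x, hk]
  rw [abs_of_pos hx0]
  by_contra! hcon
  exact hx.2 ⟨hx0, hcon.le⟩

theorem continuous_rpow (h : IsProfile q L ψ) (hq : 1 < q) : Continuous fun x => ψ x ^ q :=
  (Real.continuous_rpow_const (by linarith)).comp h.continuous

/-- The integral of `ψ'² / 2` over `(0, L)` is the integral of the weight over the heights. -/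
theorem integral_sub_rpow (h : IsProfile q L ψ) (hq : 1 < q) :
    ∫ x in (0 : ℝ)..L, 2 * (ψ x - ψ x ^ q) = ∫ t in (0 : ℝ)..1, weight q t := by
  let H : ℝ → ℝ := fun y => -∫ s in (0 : ℝ)..y, weight q s
  have hc := continuous_weight hq
  have hH : ∀ y, HasDerivAt H (-weight q y) y := fun y =>
    (intervalIntegral.integral_hasDerivAt_right (hc.intervalIntegrable _ _)
      hc.stronglyMeasurable.stronglyMeasurableAtFilter hc.continuousAt).neg
  have hHc : Continuous H := continuous_iff_continuousAt.2 fun y => (hH y).continuousAt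
  have hfc : Continuous fun x => 2 * (ψ x - ψ x ^ q) :=
    continuous_const.mul (h.continuous.sub (h.continuous_rpow hq))
  rw [intervalIntegral.integral_eq_sub_of_hasDerivAt_of_le (f := fun x => H (ψ x))
    h.length_pos.le (hHc.comp h.continuous).continuousOn (fun x hx => ?_)
    (hfc.intervalIntegrable _ _)]
  · rw [h.apply_zero, h.eq_zero L (le_abs_self L)]
    simp [H]
  · have hd := (hH (ψ x)).comp x (h.hasDerivAt x hx)
    refine hd.congr_deriv ?_
    rw [← h.weight_sq hq]
    ring

/-- Pohozaev-type identity, from integrating `(ψ ψ')'` over `(0, L)`. -/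
theorem integral_pohozaev (h : IsProfile q L ψ) (hq : 1 < q) :
    ∫ x in (0 : ℝ)..L, (6 * ψ x - (4 + 2 * q) * ψ x ^ q) = 0 := by
  have hfc : Continuous fun x => 6 * ψ x - (4 + 2 * q) * ψ x ^ q :=
    (continuous_const.mul h.continuous).sub (continuous_const.mul (h.continuous_rpow hq))
  rw [intervalIntegral.integral_eq_sub_of_hasDerivAt_of_le
    (f := fun x => ψ x * -(2 * weight q (ψ x)))
    h.length_pos.le (h.continuous.mul (continuous_const.mul
      ((continuous_weight hq).comp h.continuous)).neg).continuousOn (fun x hx => ?_)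
    (hfc.intervalIntegrable _ _)]
  · rw [h.apply_zero, h.eq_zero L (le_abs_self L)]
    simp [weight]
  · have hm := h.mem_Ioo x hx
    have hw := weight_pos hq hm.1 hm.2
    have hsq := h.weight_sq hq x
    have hψ := h.hasDerivAt x hx
    have hd := hψ.mul ((((hψ.sub (hψ.rpow_const (p := q) (Or.inl hm.1.ne'))).sqrt
      (Real.sqrt_pos.1 hw).ne').const_mul 2).neg)
    refine hd.congr_deriv ?_
    change -(2 * weight q (ψ x)) * -(2 * weight q (ψ x)) +
      ψ x * -(2 * (_ / (2 * weight q (ψ x)))) = _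
    have hr : ψ x ^ (q - 1) = ψ x ^ q / ψ x := Real.rpow_sub_one hm.1.ne' q
    have hm0 := hm.1.ne'
    rw [hr]
    field_simp
    linear_combination 4 * hsq

/-- The mass identities of the profile. -/
theorem integral_eq (h : IsProfile q L ψ) (hq : 1 < q) :
    ∫ x, ψ x = (∫ t in (0 : ℝ)..1, weight q t) + ∫ x, ψ x ^ q ∧
      3 * ∫ t in (0 : ℝ)..1, weight q t = (q - 1) * ∫ x, ψ x ^ q := by
  have hq0 : (0 : ℝ) ^ q = 0 := Real.zero_rpow (by linarith)
  have h1 := h.integral_comp (k := fun t => t) rfl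
  have h2 := h.integral_comp (k := fun t => t ^ q) hq0
  have h3 := h.integral_sub_rpow hq
  have h4 := h.integral_pohozaev hq
  have i1 : IntervalIntegrable ψ volume 0 L := h.continuous.intervalIntegrable _ _
  have i2 : IntervalIntegrable (fun x => ψ x ^ q) volume 0 L :=
    (h.continuous_rpow hq).intervalIntegrable _ _
  rw [intervalIntegral.integral_const_mul, intervalIntegral.integral_sub i1 i2] at h3
  rw [intervalIntegral.integral_sub (i1.const_mul _) (i2.const_mul _),
    intervalIntegral.integral_const_mul, intervalIntegral.integral_const_mul] at h4
  beta_reduce at h1 h2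
  constructor <;> nlinarith

theorem integral_rpow_pos (h : IsProfile q L ψ) (hq : 1 < q) : 0 < ∫ x, ψ x ^ q := by
  have hq0 : (0 : ℝ) ^ q = 0 := Real.zero_rpow (by linarith)
  refine (h.continuous_rpow hq).integral_pos_of_hasCompactSupport_nonneg_nonzero
    (h.hasCompactSupport_comp (k := fun t => t ^ q) hq0)
    (fun x => Real.rpow_nonneg (h.nonneg x) q) (x := 0) ?_
  simp [h.apply_zero]

/-- The derivative of the profile, with value `0` at the top. -/
noncomputable def slope (q : ℝ) (ψ : ℝ → ℝ) (x : ℝ) : ℝ :=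
  -(SignType.sign x : ℝ) * (2 * weight q (ψ x))

theorem abs_slope_le (x : ℝ) : |slope q ψ x| ≤ 2 * weight q (ψ x) := by
  have hw := weight_nonneg q (ψ x)
  rw [slope, abs_mul, abs_of_nonneg (by positivity : 0 ≤ 2 * weight q (ψ x))]
  refine mul_le_of_le_one_left (by positivity) ?_
  rcases lt_trichotomy x 0 with hx | rfl | hx <;> simp [*]

theorem slope_sq (h : IsProfile q L ψ) (hq : 1 < q) {x : ℝ} (hx : x ≠ 0) :
    slope q ψ x ^ 2 = 4 * (ψ x - ψ x ^ q) := by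
  rw [slope, mul_pow, mul_pow, h.weight_sq hq]
  rcases lt_or_gt_of_ne hx with hx | hx <;> simp only [hx, sign_neg, sign_pos] <;>
    norm_num

theorem measurable_slope (h : IsProfile q L ψ) (hq : 1 < q) : Measurable (slope q ψ) := by
  have h1 : Measurable fun x : ℝ => (SignType.sign x : ℝ) := by
    have h2 : (fun x : ℝ => (SignType.sign x : ℝ)) =
        (Ioi (0 : ℝ)).piecewise (fun _ => 1)
          ((Iio (0 : ℝ)).piecewise (fun _ => -1) fun _ => 0) := by
      funext x
      rcases lt_trichotomy x 0 with hx | rfl | hx <;> simp [piecewise, *, le_of_lt]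
    rw [h2]
    exact measurable_const.piecewise measurableSet_Ioi
      (measurable_const.piecewise measurableSet_Iio measurable_const)
  exact h1.neg.mul (((continuous_weight hq).comp h.continuous).measurable.const_mul 2)

theorem weight_zero (hq : 1 < q) : weight q 0 = 0 := by
  simp [weight, Real.zero_rpow (by linarith : q ≠ 0)]

theorem integrable_slope (h : IsProfile q L ψ) (hq : 1 < q) : Integrable (slope q ψ) volume :=
  (h.integrable_comp (k := fun t => 2 * weight q t)
    (continuous_const.mul (continuous_weight hq)) (by simp [weight_zero hq])).mono'
    (h.measurable_slope hq).aestronglyMeasurable (Filter.Eventually.of_forall abs_slope_le)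

theorem memLp_slope (h : IsProfile q L ψ) (hq : 1 < q) : MemLp (slope q ψ) 2 volume := by
  rw [memLp_two_iff_integrable_sq (h.measurable_slope hq).aestronglyMeasurable]
  refine (h.integrable_comp (k := fun t => (2 * weight q t) ^ 2)
    ((continuous_const.mul (continuous_weight hq)).pow 2) (by simp [weight_zero hq])).mono'
    ((h.measurable_slope hq).pow_const 2).aestronglyMeasurable
    (Filter.Eventually.of_forall fun x => ?_)
  rw [Real.norm_eq_abs, abs_pow]
  exact pow_le_pow_left₀ (abs_nonneg _) (abs_slope_le x) 2

theorem hasDerivAt_slope (h : IsProfile q L ψ) (hq : 1 < q) {x : ℝ} (h0 : x ≠ 0)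
    (hL : |x| ≠ L) : HasDerivAt ψ (slope q ψ x) x := by
  rcases lt_or_gt_of_ne hL with hx | hx
  · rcases lt_or_gt_of_ne h0 with h0 | h0
    · rw [abs_of_neg h0] at hx
      have hd := h.hasDerivAt (-x) ⟨by linarith, hx⟩
      have h1 := hd.comp x (hasDerivAt_neg x)
      rw [show ψ ∘ Neg.neg = ψ from funext h.even] at h1
      refine h1.congr_deriv ?_
      simp [slope, h0, h.even]
    · rw [abs_of_pos h0] at hx
      refine (h.hasDerivAt x ⟨h0, hx⟩).congr_deriv ?_
      simp [slope, h0]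
  · have hev : ψ =ᶠ[nhds x] fun _ => 0 := by
      filter_upwards [(isOpen_lt continuous_const continuous_abs).mem_nhds hx] with y hy
      exact h.eq_zero y (le_of_lt hy)
    refine ((hasDerivAt_const x (0 : ℝ)).congr_of_eventuallyEq hev).congr_deriv ?_
    simp [slope, hev.eq_of_nhds, weight_zero hq]

theorem eq_primitive (h : IsProfile q L ψ) (hq : 1 < q) (x : ℝ) :
    ψ x = ψ 0 + ∫ t in (0 : ℝ)..x, slope q ψ t := by
  rw [integral_eq_of_hasDerivAt_off_countable ψ (slope q ψ) (s := {0, L, -L})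
    (by simp) h.continuous.continuousOn
    (fun y hy => ?_) (h.integrable_slope hq).intervalIntegrable]
  · ring
  · have hy2 := hy.2
    simp only [mem_insert_iff, mem_singleton_iff, not_or] at hy2
    refine h.hasDerivAt_slope hq hy2.1 fun habs => ?_
    rcases abs_choice y with hc | hc <;> rw [hc] at habs
    · exact hy2.2.1 habs
    · exact hy2.2.2 (by linarith)

end IsProfile

end Compacton

namespace Compacton

/-! ### Symmetric rearrangement of a bell-shaped function -/

/-- A continuous bell-shaped function equals its symmetric rearrangement: for `s > 0` the level set
`{φ > s}` has measure at most `2|x|` exactly when `φ x ≤ s`. -/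
theorem symmRearr_eq_self {φ : ℝ → ℝ} (hc : Continuous φ) (heven : ∀ x, φ (-x) = φ x)
    (h0 : ∀ x, 0 ≤ φ x) (hanti : AntitoneOn φ (Ici 0)) : symmRearr φ = φ := by
  have habs : ∀ x, φ |x| = φ x := fun x => by
    rcases abs_choice x with hx | hx <;> rw [hx]
    exact heven x
  funext x
  have hset : {s : ℝ | 0 < s ∧ distribFun φ s ≤ ENNReal.ofReal (2 * |x|)} =
      {s : ℝ | 0 < s ∧ φ x ≤ s} := by
    ext s
    refine and_congr_right fun hs => ?_
    constructor
    · intro hd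
      by_contra! hlt
      rw [← habs] at hlt
      -- By continuity the level set contains an interval longer than `2|x|`.
      obtain ⟨δ, hδ, hδ'⟩ := Metric.mem_nhds_iff.1
        ((isOpen_lt continuous_const hc).mem_nhds (show |x| ∈ {y | s < φ y} from hlt))
      have hmem : s < φ (|x| + δ / 2) :=
        hδ' (by rw [Metric.mem_ball, Real.dist_eq, add_sub_cancel_left, abs_of_pos] <;> linarith)
      have hsub : Icc (-(|x| + δ / 2)) (|x| + δ / 2) ⊆ {y | s < |φ y|} := by
        intro y hy
        change s < |φ y|
        rw [abs_of_nonneg (h0 y), ← habs y]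
        exact hmem.trans_le (hanti (abs_nonneg y) (by rw [mem_Ici]; positivity) (abs_le.2 hy))
      have hle := (measure_mono hsub).trans hd
      rw [Real.volume_Icc, ENNReal.ofReal_le_ofReal_iff (by positivity)] at hle
      linarith
    · intro hle
      have hsub : {y | s < |φ y|} ⊆ Icc (-|x|) |x| := by
        intro y hy
        rw [mem_ofPred_eq, abs_of_nonneg (h0 y), ← habs y] at hy
        rw [← habs x] at hle
        refine abs_le.1 ?_
        by_contra! hcon
        exact absurd (hy.trans_le (hanti (abs_nonneg x) (abs_nonneg y) hcon.le)) (not_lt.2 hle)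
      refine (measure_mono hsub).trans ?_
      rw [Real.volume_Icc]
      exact ENNReal.ofReal_le_ofReal (by linarith)
  rw [symmRearr, decrRearr, hset]
  rcases (h0 x).eq_or_lt with hx | hx
  · rw [← hx, show {s : ℝ | 0 < s ∧ 0 ≤ s} = Ioi 0 from
      ext fun s => ⟨fun h => h.1, fun h => ⟨h, le_of_lt h⟩⟩]
    exact csInf_Ioi
  · rw [show {s : ℝ | 0 < s ∧ φ x ≤ s} = Ici (φ x) from
      ext fun s => ⟨fun h => h.2, fun h => ⟨hx.trans_le h, h⟩⟩]
    exact csInf_Ici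

/-! ### The energy of admissible functions and of the rescaled profile -/

theorem IsWeakDeriv.energy_eq {v g : ℝ → ℝ} (h : IsWeakDeriv v g) (ω : ℝ) :
    energy ω v = (1 / 4) * (∫ x, |g x| ^ 2) + ω * ∫ x, |v x| := by
  rw [energy]
  congr 2
  refine integral_congr_ae ?_
  filter_upwards [h.ae_eq_weakDeriv] with x hx
  rw [hx]

/-- The lower bound for the energy, passed to the absolutely continuous representative. -/
theorem exists_le_energy {p ω : ℝ} (hp : 2 < p) (hω : 0 < ω) {v : ℝ → ℝ}
    (hv : v ∈ constraintSet p) :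
    ∃ A > 0, ω * A ^ (1 - p / 2) + 2 * (√(ω * A) * A * ∫ t in (0 : ℝ)..1, weight (p / 2) t) ≤
      energy ω v := by
  obtain ⟨⟨hv2, g, hg, hg2⟩, hvi, hvq, hv1⟩ := hv
  obtain ⟨F, hvF, hF⟩ := hg.exists_primitive
  have hq : (fun x => |v x| ^ (p / 2)) =ᵐ[volume] fun x => |F x| ^ (p / 2) :=
    hvF.fun_comp fun t => |t| ^ (p / 2)
  obtain ⟨A, hA, hle⟩ := exists_le_energy_of_primitive (q := p / 2) (by linarith) hω hg.2.1 hF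
    (hvi.congr hvF) (hv2.ae_eq hvF) hg2 (hvq.congr hq) (by rw [← integral_congr_ae hq, hv1])
  refine ⟨A, hA, ?_⟩
  have habs : (fun x => |v x|) =ᵐ[volume] fun x => |F x| := hvF.fun_comp fun t => |t|
  rwa [hg.energy_eq, integral_congr_ae habs]

/-- The lower bound, as a function of the relative height `r`, is smallest at `r = 1`. -/
theorem one_add_le_rpow_add {q r : ℝ} (hq : 1 < q) (hr : 0 < r) :
    1 + 2 * (q - 1) / 3 ≤ r ^ (1 - q) + 2 * (q - 1) / 3 * (√r * r) := by
  have h1 : 1 + Real.log r * (1 - q) ≤ r ^ (1 - q) := by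
    rw [Real.rpow_def_of_pos hr]
    linarith [Real.add_one_le_exp (Real.log r * (1 - q))]
  have h2 : 1 + Real.log r * (3 / 2) ≤ √r * r := by
    rw [Real.sqrt_eq_rpow, ← Real.rpow_add_one hr.ne', Real.rpow_def_of_pos hr]
    have := Real.add_one_le_exp (Real.log r * (1 / 2 + 1))
    linarith
  have h3 := mul_le_mul_of_nonneg_left h2 (by linarith : 0 ≤ 2 * (q - 1) / 3)
  nlinarith

/-- The height at which the rescaled profile satisfies the constraint. -/
theorem exists_height {q ω J : ℝ} (hq : 1 < q) (hω : 0 < ω) (hJ : 0 < J) :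
    ∃ A > 0, A ^ q * J = √(ω / A) := by
  refine ⟨(√ω / J) ^ (q + 1 / 2)⁻¹, by positivity, ?_⟩
  have hA : 0 < (√ω / J) ^ (q + 1 / 2)⁻¹ := by positivity
  have h := Real.rpow_inv_rpow (x := √ω / J) (by positivity) (by linarith : q + 1 / 2 ≠ 0)
  rw [Real.rpow_add hA, ← Real.sqrt_eq_rpow] at h
  have hs := Real.sqrt_pos.2 hA
  rw [eq_div_iff hJ.ne'] at h
  rw [Real.sqrt_div hω.le, eq_div_iff hs.ne']
  linarith

theorem IsProfile.integral_abs_rescale {q L A k : ℝ} {ψ : ℝ → ℝ} (h : IsProfile q L ψ)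
    (hA : 0 < A) (hk : 0 < k) : ∫ x, |A * ψ (k * x)| = A / k * ∫ x, ψ x := by
  have h1 : ∀ x, |A * ψ (k * x)| = A * ψ (k * x) := fun x =>
    abs_of_nonneg (mul_nonneg hA.le (h.nonneg _))
  simp only [h1]
  rw [integral_const_mul, Measure.integral_comp_mul_left, abs_of_pos (inv_pos.2 hk), smul_eq_mul]
  ring

theorem IsProfile.abs_rescale_rpow {q L A k : ℝ} {ψ : ℝ → ℝ} (h : IsProfile q L ψ)
    (hA : 0 < A) (x : ℝ) : |A * ψ (k * x)| ^ q = A ^ q * ψ (k * x) ^ q := by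
  rw [abs_of_nonneg (mul_nonneg hA.le (h.nonneg _)), Real.mul_rpow hA.le (h.nonneg _)]

theorem IsProfile.integral_rescale_rpow {q L A k : ℝ} {ψ : ℝ → ℝ} (h : IsProfile q L ψ)
    (hA : 0 < A) (hk : 0 < k) :
    ∫ x, |A * ψ (k * x)| ^ q = A ^ q / k * ∫ x, ψ x ^ q := by
  simp only [h.abs_rescale_rpow hA]
  rw [integral_const_mul, Measure.integral_comp_mul_left (fun x => ψ x ^ q),
    abs_of_pos (inv_pos.2 hk), smul_eq_mul]
  ring

theorem IsProfile.isWeakDeriv_rescale {q L : ℝ} {ψ : ℝ → ℝ} (h : IsProfile q L ψ) (hq : 1 < q)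
    (A : ℝ) {k : ℝ} (hk : 0 < k) :
    IsWeakDeriv (fun x => A * ψ (k * x)) (fun x => A * (k * slope q ψ (k * x))) := by
  refine isWeakDeriv_of_primitive
    ((((h.integrable_slope hq).comp_mul_left' hk.ne').const_mul k).const_mul A).locallyIntegrable
    fun x => ?_
  rw [intervalIntegral.integral_const_mul, intervalIntegral.integral_const_mul,
    intervalIntegral.mul_integral_comp_mul_left, mul_zero, h.eq_primitive hq (k * x)]
  ring

theorem memLp_two_comp_mul_left {f : ℝ → ℝ} (hf : MemLp f 2 volume) (hm : Measurable f) {k : ℝ}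
    (hk : k ≠ 0) : MemLp (fun x => f (k * x)) 2 volume := by
  have hm' : Measurable fun x => f (k * x) := hm.comp (measurable_const_mul k)
  rw [memLp_two_iff_integrable_sq hm'.aestronglyMeasurable]
  exact hf.integrable_sq.comp_mul_left' hk

theorem IsProfile.integral_slope_rescale_sq {q L A k : ℝ} {ψ : ℝ → ℝ} (h : IsProfile q L ψ)
    (hq : 1 < q) (hk : 0 < k) :
    ∫ x, |A * (k * slope q ψ (k * x))| ^ 2 =
      4 * (A ^ 2 * k) * ∫ t in (0 : ℝ)..1, weight q t := by
  have hq0 : (0 : ℝ) ^ q = 0 := Real.zero_rpow (by linarith)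
  have h1 : ∫ x, slope q ψ x ^ 2 = 4 * ∫ t in (0 : ℝ)..1, weight q t := by
    have h2 : ∫ x, slope q ψ x ^ 2 = ∫ x, 4 * (ψ x - ψ x ^ q) := by
      refine integral_congr_ae ?_
      filter_upwards [compl_mem_ae_iff.2 (measure_singleton (0 : ℝ))] with x hx
      exact h.slope_sq hq hx
    rw [h2, integral_const_mul, integral_sub (h.integrable_comp (k := fun t => t) continuous_id rfl)
      (h.integrable_comp (Real.continuous_rpow_const (by linarith : 0 ≤ q)) hq0)]
    have := (h.integral_eq hq).1
    linarith
  simp only [sq_abs, mul_pow]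
  rw [integral_const_mul, integral_const_mul,
    Measure.integral_comp_mul_left (fun x => slope q ψ x ^ 2), h1, abs_of_pos (inv_pos.2 hk),
    smul_eq_mul]
  field_simp

end Compacton

open Compacton in
theorem proposition2 (p ω : ℝ) (hp : 2 < p) (hω : 0 < ω) :
    ∃ φ : ℝ → ℝ,
      φ ∈ Compacton.constraintSet p ∧
      IsMinOn (Compacton.energy ω) (Compacton.constraintSet p) φ ∧
      Compacton.BellShaped φ ∧
      φ = Compacton.symmRearr φ := by
  have hq : 1 < p / 2 := by linarith
  have hq0 : (0 : ℝ) ^ (p / 2) = 0 := Real.zero_rpow (by linarith)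
  obtain ⟨L, ψ, h⟩ := exists_isProfile hq
  obtain ⟨hI, hK⟩ := h.integral_eq hq
  have hJ := h.integral_rpow_pos hq
  obtain ⟨A, hA, hAJ⟩ := exists_height hq hω hJ
  set J := ∫ x, ψ x ^ (p / 2)
  set K := ∫ t in (0 : ℝ)..1, weight (p / 2) t
  set k := √(ω / A)
  have hk : 0 < k := Real.sqrt_pos.2 (by positivity)
  have hk2 : k ^ 2 = ω / A := Real.sq_sqrt (by positivity)
  have hw := h.isWeakDeriv_rescale hq A hk
  have hc : Continuous fun x => A * ψ (k * x) :=
    continuous_const.mul (h.continuous.comp (continuous_const.mul continuous_id))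
  have heven : ∀ x, A * ψ (k * -x) = A * ψ (k * x) := fun x => by rw [mul_neg, h.even]
  have hnn : ∀ x, 0 ≤ A * ψ (k * x) := fun x => mul_nonneg hA.le (h.nonneg _)
  have hanti : AntitoneOn (fun x => A * ψ (k * x)) (Ici 0) := fun x hx y hy hxy =>
    mul_le_mul_of_nonneg_left (h.antitoneOn (mul_nonneg hk.le hx) (mul_nonneg hk.le hy)
      (mul_le_mul_of_nonneg_left hxy hk.le)) hA.le
  have hψ2 : MemLp ψ 2 volume := by
    rw [memLp_two_iff_integrable_sq h.continuous.aestronglyMeasurable]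
    exact h.integrable_comp (continuous_pow 2) (by simp)
  refine ⟨fun x => A * ψ (k * x), ⟨⟨?_, _, hw, ?_⟩, ?_, ?_, ?_⟩, ?_,
    ⟨heven, hnn, hanti.mono Ioi_subset_Ici_self⟩, (symmRearr_eq_self hc heven hnn hanti).symm⟩
  · exact (memLp_two_comp_mul_left hψ2 h.continuous.measurable hk.ne').const_mul A
  · exact ((memLp_two_comp_mul_left (h.memLp_slope hq) (h.measurable_slope hq)
      hk.ne').const_mul k).const_mul A
  · exact ((h.integrable_comp continuous_id rfl).comp_mul_left' hk.ne').const_mul A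
  · simp only [h.abs_rescale_rpow hA]
    exact ((h.integrable_comp (Real.continuous_rpow_const (by linarith : 0 ≤ p / 2))
      hq0).comp_mul_left' hk.ne').const_mul _
  · rw [h.integral_rescale_rpow hA hk, div_mul_eq_mul_div, hAJ, div_self hk.ne']
  · intro v hv
    obtain ⟨B, hB, hle⟩ := exists_le_energy hp hω hv
    refine le_trans ?_ hle
    rw [hw.energy_eq, h.integral_slope_rescale_sq hq hk, h.integral_abs_rescale hA hk, hI]
    -- Everything is expressed through `P = A² k = ω A / k` and the ratio `r = B / A`.
    obtain ⟨r, hr, rfl⟩ : ∃ r > 0, B = A * r := ⟨B / A, by positivity, by field_simp⟩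
    have hωk : ω = k ^ 2 * A := by rw [hk2]; field_simp
    have hs : √(ω * (A * r)) = k * A * √r := by
      rw [hωk, show k ^ 2 * A * (A * r) = (k * A) ^ 2 * r by ring, Real.sqrt_mul (by positivity),
        Real.sqrt_sq (by positivity)]
    have hpow : ω * (A * r) ^ (1 - p / 2) = A ^ 2 * k * J * r ^ (1 - p / 2) := by
      rw [Real.mul_rpow hA.le hr.le, Real.rpow_sub hA, Real.rpow_one, hωk]
      have := (Real.rpow_pos_of_pos hA (p / 2)).ne'
      field_simp
      linear_combination (-1 : ℝ) * hAJ
    change (1 / 4) * (4 * (A ^ 2 * k) * K) + ω * (A / k * (K + J)) ≤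
      ω * (A * r) ^ (1 - p / 2) + 2 * (√(ω * (A * r)) * (A * r) * K)
    rw [hs, hpow]
    have hfin := mul_le_mul_of_nonneg_left (one_add_le_rpow_add hq hr)
      (by positivity : 0 ≤ A ^ 2 * k * J)
    have hKJ : K = (p / 2 - 1) * J / 3 := by linarith
    have hωA : ω * (A / k * (K + J)) = A ^ 2 * k * (K + J) := by
      rw [hωk]
      field_simp
    rw [hωA, hKJ]
    linear_combination hfin
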